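/- Let $\lambda=1+\sqrt2$. Consider the twisted silver mean inflation $a\mapsto ab\bar a$, $b\mapsto\bar a$, $\bar a\mapsto\bar a\bar b a$, $\bar b\mapsto a$ on the four prototiles $a,b,\bar a,\bar b$, which are intervals of length $\lambda$ (for $a,\bar a$) and $1$ (for $b,\bar b$). Let its hull $\Omega$ be the set of all tilings of $\mathbb R$ by translates of these prototiles in which every finite sequence of consecutive tiles is a subword of some $n$-fold inflated prototile. For a tiling $\omega\in\Omega$ let $\varLambda$ be the set of left endpoints of its tiles, let $w(x)=1$ (resp. $w(x)=-1$) if $x\in\varLambda$ is the left endpoint of an unbarred (resp. barred) tile, and put $\varLambda_R=\varLambda\cap(-R,R)$. Then $\Omega\neq\varnothing$; for every $z\in\mathbb R$ the limit $$\nu_{\mathsf{tsm}}(z)=\lim_{R\to\infty}\frac1{|\varLambda_R|}\sum_{\substack{x,y\in\varLambda_R\\ x-y=z}}w(x)\,w(y)$$ exists for every $\omega\in\Omega$ and does not depend on $\omega$; and $$\lim_{n\to\infty}\nu_{\mathsf{tsm}}(z_n)=1-\sqrt2,\qquad z_n=(1+\lambda)\lambda^n .$$ In particular, $\nu_{\mathsf{tsm}}(z)$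 does not tend to $0$ as $z\to\infty$. -/

import Mathlib

open Filter Topology

namespace TSM

/-- The prototiles: long tile `a`, short tile `b`, and their barred versions. -/
inductive Tile
  | a
  | b
  | abar
  | bbar

/-- The silver mean `λ = 1 + √2`. -/
noncomputable def lam : ℝ := 1 + √2

namespace Tile

/-- The natural tile lengths: `λ` for long tiles and `1` for short tiles. -/
noncomputable def length : Tile → ℝ
  | a => lam
  | b => 1
  | abar => lam
  | bbar => 1

/-- The weight `+1` for unbarred tiles and `-1` for barred tiles. -/
def weight : Tile → ℝ
  | a => 1
  | b => 1
  | abar => -1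
  | bbar => -1

/-- The twisted silver mean inflation rule on prototiles. -/
def inflate : Tile → List Tile
  | a => [a, b, abar]
  | b => [abar]
  | abar => [abar, bbar, a]
  | bbar => [a]

lemma one_le_length (t : Tile) : 1 ≤ t.length := by
  have h : (0 : ℝ) ≤ √2 := Real.sqrt_nonneg 2
  cases t <;> simp [length, lam]

end Tile

/-- The inflation rule on finite words. -/
def inflateWord (w : List Tile) : List Tile := w.flatMap Tile.inflate

/-- A word is legal if it is a (contiguous) subword of some `n`-fold inflated prototile. -/
def Legal (w : List Tile) : Prop := ∃ (t : Tile) (n : ℕ), w <:+: inflateWord^[n] [t]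

/-- A tiling of the line by translates of the prototiles: the tiles are enumerated by `ℤ` from
left to right, and `left i` is the left endpoint of the `i`-th tile. Consecutive tiles abut; as
all lengths are at least `1`, the tiles cover the whole line. -/
structure Tiling where
  tile : ℤ → Tile
  left : ℤ → ℝ
  left_succ : ∀ i, left (i + 1) = left i + (tile i).length

/-- The hull of the twisted silver mean inflation: all tilings in which every finite sequence of
consecutive tiles is legal. -/
def hull : Set Tiling :=
  {T | ∀ (i : ℤ) (n : ℕ), Legal ((List.range n).map fun k => T.tile (i + k))}

namespace Tiling

variable (T : Tiling)

/-- The set `Λ` of all left endpoints of tiles. -/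
def points : Set ℝ := Set.range T.left

open scoped Classical in
/-- The weight `w(x)`: `+1` (or `-1`) if `x` is the left endpoint of an unbarred (or barred) tile;
it is set to `0` off `Λ`. -/
noncomputable def w (x : ℝ) : ℝ :=
  if h : x ∈ T.points then (T.tile h.choose).weight else 0

lemma left_add_le (i : ℤ) (n : ℕ) : T.left i + n ≤ T.left (i + n) := by
  induction n with
  | zero => simp
  | succ n ih =>
    have h := T.left_succ (i + n)
    have h1 := (T.tile (i + n)).one_le_length
    push_cast
    rw [← add_assoc i, h]
    linarith

lemma sub_le_left_sub {i j : ℤ} (h : i ≤ j) : ((j - i : ℤ) : ℝ) ≤ T.left j - T.left i := by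
  obtain ⟨n, rfl⟩ := Int.le.dest h
  have := T.left_add_le i n
  push_cast
  linarith

lemma left_strictMono : StrictMono T.left := by
  intro i j h
  have h1 := T.sub_le_left_sub h.le
  have h2 : (0 : ℝ) < ((j - i : ℤ) : ℝ) := by exact_mod_cast sub_pos.mpr h
  linarith

lemma w_left (i : ℤ) : T.w (T.left i) = (T.tile i).weight := by
  have h : T.left i ∈ T.points := ⟨i, rfl⟩
  have h1 : h.choose = i := T.left_strictMono.injective h.choose_spec
  rw [w, dif_pos h, h1]

lemma finite_points_inter (R : ℝ) : (T.points ∩ Set.Ioo (-R) R).Finite := by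
  have key : {i : ℤ | T.left i ∈ Set.Ioo (-R) R}.Finite := by
    obtain ⟨N, hN⟩ := exists_nat_ge (R + |T.left 0|)
    refine (Set.finite_Icc (-(N : ℤ)) N).subset ?_
    intro i hi
    obtain ⟨h1, h2⟩ := hi
    have h3 := abs_le.mp (le_refl |T.left 0|)
    have hN' : R + |T.left 0| ≤ ((N : ℤ) : ℝ) := by exact_mod_cast hN
    rcases le_total 0 i with h | h
    · have h4 := T.sub_le_left_sub h
      have h5 : (i : ℝ) ≤ ((N : ℤ) : ℝ) := by push_cast at h4 hN' ⊢; linarith [h3.1]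
      have h6 : i ≤ N := by exact_mod_cast h5
      constructor <;> omega
    · have h4 := T.sub_le_left_sub h
      have h5 : ((-i : ℤ) : ℝ) ≤ ((N : ℤ) : ℝ) := by push_cast at h4 hN' ⊢; linarith [h3.2]
      have h6 : -i ≤ N := by exact_mod_cast h5
      constructor <;> omega
  refine (key.image T.left).subset ?_
  rintro _ ⟨⟨i, rfl⟩, hi⟩
  exact ⟨i, hi, rfl⟩

/-- The finite set `Λ_R = Λ ∩ (-R, R)`. -/
noncomputable def pointsIn (R : ℝ) : Finset ℝ := (T.finite_points_inter R).toFinset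

/-- The finite-size approximant, over the interval `(-R, R)`, of the relative autocorrelation
coefficient at distance `z`. -/
noncomputable def autocorr (z R : ℝ) : ℝ :=
  (1 / ((T.pointsIn R).card : ℝ)) *
    ∑ p ∈ T.pointsIn R ×ˢ T.pointsIn R with p.1 - p.2 = z, T.w p.1 * T.w p.2

end Tiling

/-- `ν` is the relative autocorrelation of the twisted silver mean tilings: for every tiling in
the hull and every `z`, the defining limit exists and equals `ν z`. -/
def IsAutocorrelation (ν : ℝ → ℝ) : Prop :=
  ∀ T ∈ hull, ∀ z : ℝ, Tendsto (fun R : ℝ => T.autocorr z R) atTop (𝓝 (ν z))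

end TSM

/-!
Every sufficiently long legal word is, up to its two ends, a concatenation of level-`n` supertiles.
The autocorrelation `corr w w z` of a word at a fixed distance `z` is additive under concatenation
up to an error bounded in terms of `z` only (`abs_autocorr_append_sub_le`) and is invariant under
exchanging barred and unbarred tiles. The numbers of long and short tiles in a legal word have
ratio `λ` up to a bounded discrepancy, because the discrepancy is an eigenvector of the inflation
matrix for the eigenvalue `-1 / λ`. Hence the mean autocorrelation per tile over any long legal
word is determined by the level-`n` supertiles, up to an error of order `1 / shortLen n`, and it
converges uniformly over all legal words (`exists_isUniformMean`). As the patch of a tiling in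
`(-R, R)` is a legal word, this gives the existence of `ν` and its independence of the tiling. That
the hull is nonempty follows from compactness.

The mean at distance `(1 + λ) λⁿ` may therefore be computed along the words `ρⁿ(ρ(w))` with `ρ` the
inflation and `w = ρᵐ(a)`. The distance is the length of one long and one short supertile of level
`n`, so the task is to compare the row `ρ(w)` with the row obtained by deleting its first two tiles,
and then to inflate both `n` times. The two rows decompose into balanced pairs of words of equal
length. Only three kinds occur: two long tiles of opposite sign, a long and a short tile in the two
possible orders, and a short tile moved across two long ones. The overlaps of their inflations
satisfy a linear recursion with a closed form (`overlap_ab_b_abar`, `overlap_b_abar_abar`), and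
which pairs occur how often is read off from the letter counts of `w` and from the signs of adjacent
long tiles (`Patterned.overlap_drop`, `adjacency_iterate`). In the limit `m → ∞` this yields an
exact formula for `ν` (`IsUniformMean.eq_div`), and `n → ∞` then gives `1 - √2`.
-/

namespace TSM

/-! ### Words: lengths, letter counts and the bar symmetry -/

lemma lam_sq : lam ^ 2 = 2 * lam + 1 := by
  have h : √2 ^ 2 = (2 : ℝ) := Real.sq_sqrt (by norm_num)
  unfold lam
  linear_combination h

lemma two_lt_lam : 2 < lam := by
  have : (1 : ℝ) < √2 := Real.lt_sqrt_of_sq_lt (by norm_num)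
  unfold lam
  linarith

lemma lam_lt_three : lam < 3 := by
  have : √2 < (2 : ℝ) := (Real.sqrt_lt' (by norm_num)).2 (by norm_num)
  unfold lam
  linarith

/-- Exchange of barred and unbarred tiles. -/
def Tile.bar : Tile → Tile
  | .a => .abar
  | .b => .bbar
  | .abar => .a
  | .bbar => .b

/-- Real-valued indicator of the long tiles. -/
def Tile.long : Tile → ℝ
  | .a => 1
  | .b => 0
  | .abar => 1
  | .bbar => 0

/-- Real-valued indicator of the short tiles. -/
def Tile.short : Tile → ℝ
  | .a => 0
  | .b => 1
  | .abar => 0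
  | .bbar => 1

/-- The geometric length of a word, to be distinguished from its number of letters
`List.length`. -/
noncomputable def span (w : List Tile) : ℝ := (w.map Tile.length).sum

/-- The number of long tiles in a word, as a real number. -/
noncomputable def longCount (w : List Tile) : ℝ := (w.map Tile.long).sum

/-- The number of short tiles in a word, as a real number. -/
noncomputable def shortCount (w : List Tile) : ℝ := (w.map Tile.short).sum

@[simp] lemma span_nil : span [] = 0 := rfl
@[simp] lemma span_cons (t : Tile) (w : List Tile) : span (t :: w) = t.length + span w := by
  simp [span]
@[simp] lemma span_append (u v : List Tile) : span (u ++ v) = span u + span v := by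
  simp [span]

@[simp] lemma longCount_nil : longCount [] = 0 := rfl
@[simp] lemma longCount_cons (t : Tile) (w : List Tile) :
    longCount (t :: w) = t.long + longCount w := by
  simp [longCount]
@[simp] lemma longCount_append (u v : List Tile) :
    longCount (u ++ v) = longCount u + longCount v := by
  simp [longCount]

@[simp] lemma shortCount_nil : shortCount [] = 0 := rfl
@[simp] lemma shortCount_cons (t : Tile) (w : List Tile) :
    shortCount (t :: w) = t.short + shortCount w := by
  simp [shortCount]
@[simp] lemma shortCount_append (u v : List Tile) :
    shortCount (u ++ v) = shortCount u + shortCount v := by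
  simp [shortCount]

lemma span_eq (w : List Tile) : span w = lam * longCount w + shortCount w := by
  induction w with
  | nil => simp
  | cons t w ih => cases t <;> simp [ih, Tile.length, Tile.long, Tile.short] <;> ring

lemma length_eq (w : List Tile) : (w.length : ℝ) = longCount w + shortCount w := by
  induction w with
  | nil => simp
  | cons t w ih => cases t <;> simp [ih, Tile.long, Tile.short] <;> ring

lemma longCount_nonneg (w : List Tile) : 0 ≤ longCount w := by
  induction w with
  | nil => simp
  | cons t w ih => cases t <;> simp [Tile.long] <;> linarith

lemma shortCount_nonneg (w : List Tile) : 0 ≤ shortCount w := by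
  induction w with
  | nil => simp
  | cons t w ih => cases t <;> simp [Tile.short] <;> linarith

lemma length_le_span (w : List Tile) : (w.length : ℝ) ≤ span w := by
  have := longCount_nonneg w
  have := two_lt_lam
  rw [length_eq, span_eq]
  nlinarith

lemma span_nonneg (w : List Tile) : 0 ≤ span w :=
  (Nat.cast_nonneg _).trans (length_le_span w)

/-! ### Iterates of the inflation -/

@[simp] lemma inflateWord_nil : inflateWord [] = [] := rfl
@[simp] lemma inflateWord_cons (t : Tile) (w : List Tile) :
    inflateWord (t :: w) = t.inflate ++ inflateWord w := by
  simp [inflateWord]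
@[simp] lemma inflateWord_append (u v : List Tile) :
    inflateWord (u ++ v) = inflateWord u ++ inflateWord v := by
  simp [inflateWord]

@[simp] lemma iterate_nil (n : ℕ) : inflateWord^[n] [] = [] := by
  induction n with
  | zero => rfl
  | succ n ih => rw [Function.iterate_succ_apply, inflateWord_nil, ih]

lemma iterate_append (n : ℕ) (u v : List Tile) :
    inflateWord^[n] (u ++ v) = inflateWord^[n] u ++ inflateWord^[n] v := by
  induction n generalizing u v with
  | zero => rfl
  | succ n ih => simp [Function.iterate_succ_apply, ih]

lemma iterate_cons (n : ℕ) (t : Tile) (w : List Tile) :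
    inflateWord^[n] (t :: w) = inflateWord^[n] [t] ++ inflateWord^[n] w :=
  iterate_append n [t] w

lemma iterate_eq_flatMap (n : ℕ) (w : List Tile) :
    inflateWord^[n] w = w.flatMap fun t => inflateWord^[n] [t] := by
  induction w with
  | nil => simp
  | cons t w ih => rw [iterate_cons, ih, List.flatMap_cons]

lemma inflate_bar (t : Tile) : t.bar.inflate = t.inflate.map Tile.bar := by
  cases t <;> rfl

lemma inflateWord_bar (w : List Tile) :
    inflateWord (w.map Tile.bar) = (inflateWord w).map Tile.bar := by
  induction w with
  | nil => rfl
  | cons t w ih => simp [ih, inflate_bar]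

lemma iterate_bar (n : ℕ) (w : List Tile) :
    inflateWord^[n] (w.map Tile.bar) = (inflateWord^[n] w).map Tile.bar := by
  induction n generalizing w with
  | zero => rfl
  | succ n ih => simp only [Function.iterate_succ_apply, inflateWord_bar, ih]

lemma longCount_inflateWord (w : List Tile) :
    longCount (inflateWord w) = 2 * longCount w + shortCount w := by
  induction w with
  | nil => simp
  | cons t w ih => cases t <;> simp [ih, Tile.inflate, Tile.long, Tile.short] <;> ring

lemma shortCount_inflateWord (w : List Tile) : shortCount (inflateWord w) = longCount w := by
  induction w with
  | nil => simp
  | cons t w ih => cases t <;> simp [ih, Tile.inflate, Tile.long, Tile.short]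

lemma span_inflateWord (w : List Tile) : span (inflateWord w) = lam * span w := by
  rw [span_eq, span_eq, longCount_inflateWord, shortCount_inflateWord]
  linear_combination (-longCount w) * lam_sq

lemma span_iterate (n : ℕ) (w : List Tile) : span (inflateWord^[n] w) = lam ^ n * span w := by
  induction n generalizing w with
  | zero => simp
  | succ n ih => rw [Function.iterate_succ_apply, ih, span_inflateWord]; ring

/-- The number of letters of the `n`-fold inflated long tile. -/
noncomputable def longLen (n : ℕ) : ℝ := ((inflateWord^[n] [Tile.a]).length : ℝ)

/-- The number of letters of the `n`-fold inflated short tile. -/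
noncomputable def shortLen (n : ℕ) : ℝ := ((inflateWord^[n] [Tile.b]).length : ℝ)

lemma length_iterate_bar (n : ℕ) (t : Tile) :
    (inflateWord^[n] [t.bar]).length = (inflateWord^[n] [t]).length := by
  have := iterate_bar n [t]
  simp only [List.map_cons, List.map_nil] at this
  rw [this, List.length_map]

lemma length_iterate_singleton (n : ℕ) (t : Tile) :
    ((inflateWord^[n] [t]).length : ℝ) = t.long * longLen n + t.short * shortLen n := by
  have h1 := length_iterate_bar n .a
  have h2 := length_iterate_bar n .b
  simp only [Tile.bar] at h1 h2
  cases t <;> simp [Tile.long, Tile.short, longLen, shortLen, h1, h2]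

lemma length_iterate (n : ℕ) (w : List Tile) :
    ((inflateWord^[n] w).length : ℝ) = longCount w * longLen n + shortCount w * shortLen n := by
  induction w with
  | nil => simp
  | cons t w ih =>
    rw [iterate_cons, List.length_append, Nat.cast_add, ih, length_iterate_singleton,
      longCount_cons, shortCount_cons]
    ring

lemma longLen_zero : longLen 0 = 1 := by simp [longLen]

lemma shortLen_zero : shortLen 0 = 1 := by simp [shortLen]

lemma longLen_succ (n : ℕ) : longLen (n + 1) = 2 * longLen n + shortLen n := by
  rw [longLen, Function.iterate_succ_apply, length_iterate]
  norm_num [Tile.inflate, Tile.long, Tile.short]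

lemma shortLen_succ (n : ℕ) : shortLen (n + 1) = longLen n := by
  rw [shortLen, Function.iterate_succ_apply, length_iterate]
  simp [Tile.inflate, Tile.long, Tile.short]

lemma shortLen_le_longLen (n : ℕ) : shortLen n ≤ longLen n := by
  cases n with
  | zero => rw [longLen_zero, shortLen_zero]
  | succ n =>
    rw [longLen_succ, shortLen_succ]
    have h1 : 0 ≤ longLen n := Nat.cast_nonneg _
    have h2 : 0 ≤ shortLen n := Nat.cast_nonneg _
    linarith

lemma le_shortLen (n : ℕ) : (n : ℝ) ≤ shortLen n ∧ 1 ≤ shortLen n := by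
  induction n with
  | zero => simp [shortLen_zero]
  | succ n ih =>
    rw [shortLen_succ]
    cases n with
    | zero => simp [longLen_zero]
    | succ n =>
      have h2 : 0 ≤ shortLen n := Nat.cast_nonneg _
      rw [shortLen_succ] at ih
      rw [longLen_succ]
      push_cast at *
      constructor <;> linarith [ih.1, ih.2]

lemma length_iterate_singleton_le (n : ℕ) (t : Tile) :
    ((inflateWord^[n] [t]).length : ℝ) ≤ longLen n := by
  have := shortLen_le_longLen n
  rw [length_iterate_singleton]
  cases t <;> simp [Tile.long, Tile.short, this]

/-! ### Correlations of two words -/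

/-- The weight, at position `x`, of the word `v` laid out from the origin; it is zero if no tile
of `v` has its left endpoint at `x`. -/
noncomputable def comb : List Tile → ℝ → ℝ
  | [], _ => 0
  | t :: v, x => (if x = 0 then t.weight else 0) + comb v (x - t.length)

/-- The correlation of `u` and `v` at displacement `x`: the sum of the products of weights over
all pairs of tiles with a common left endpoint, when `v` is laid out from the origin and `u` is
laid out from `x`. -/
noncomputable def corr : List Tile → List Tile → ℝ → ℝ
  | [], _, _ => 0
  | t :: u, v, x => t.weight * comb v x + corr u v (x + t.length)

lemma Tile.length_pos (t : Tile) : 0 < t.length := one_pos.trans_le t.one_le_length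

@[simp] lemma weight_bar (t : Tile) : t.bar.weight = -t.weight := by
  cases t <;> simp [Tile.bar, Tile.weight]

@[simp] lemma length_bar (t : Tile) : t.bar.length = t.length := by
  cases t <;> simp [Tile.bar, Tile.length]

lemma weight_mul_self (t : Tile) : t.weight * t.weight = 1 := by
  cases t <;> simp [Tile.weight]

lemma abs_weight (t : Tile) : |t.weight| = 1 := by
  cases t <;> simp [Tile.weight]

lemma comb_of_neg (v : List Tile) {x : ℝ} (hx : x < 0) : comb v x = 0 := by
  induction v generalizing x with
  | nil => rfl
  | cons t v ih => rw [comb, if_neg hx.ne, ih (by linarith [t.length_pos]), add_zero]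

lemma comb_of_span_le (v : List Tile) {x : ℝ} (hx : span v ≤ x) : comb v x = 0 := by
  induction v generalizing x with
  | nil => rfl
  | cons t v ih =>
    rw [span_cons] at hx
    have := t.length_pos
    have := span_nonneg v
    rw [comb, if_neg (by linarith), ih (by linarith), add_zero]

lemma comb_append (u v : List Tile) (x : ℝ) :
    comb (u ++ v) x = comb u x + comb v (x - span u) := by
  induction u generalizing x with
  | nil => simp [comb]
  | cons t u ih => simp only [List.cons_append, comb, ih, span_cons]; ring_nf

lemma abs_comb_le (v : List Tile) (x : ℝ) : |comb v x| ≤ 1 := by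
  induction v generalizing x with
  | nil => simp [comb]
  | cons t v ih =>
    by_cases hx : x = 0
    · rw [comb, if_pos hx, comb_of_neg v (by linarith [t.length_pos]), add_zero, abs_weight]
    · rw [comb, if_neg hx, zero_add]
      exact ih _

lemma comb_bar (v : List Tile) (x : ℝ) : comb (v.map Tile.bar) x = -comb v x := by
  induction v generalizing x with
  | nil => simp [comb]
  | cons t v ih =>
    simp only [List.map_cons, comb, ih, weight_bar, length_bar]
    split_ifs <;> ring

@[simp] lemma corr_nil_left (v : List Tile) (x : ℝ) : corr [] v x = 0 := rfl

@[simp] lemma corr_nil_right (u : List Tile) (x : ℝ) : corr u [] x = 0 := by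
  induction u generalizing x with
  | nil => rfl
  | cons t u ih => simp [corr, ih, comb]

lemma corr_append_left (u₁ u₂ v : List Tile) (x : ℝ) :
    corr (u₁ ++ u₂) v x = corr u₁ v x + corr u₂ v (x + span u₁) := by
  induction u₁ generalizing x with
  | nil => simp
  | cons t u ih => simp only [List.cons_append, corr, ih, span_cons]; ring_nf

lemma corr_append_right (u v₁ v₂ : List Tile) (x : ℝ) :
    corr u (v₁ ++ v₂) x = corr u v₁ x + corr u v₂ (x - span v₁) := by
  induction u generalizing x with
  | nil => simp
  | cons t u ih => simp only [corr, ih, comb_append]; ring_nf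

lemma corr_bar_left (u v : List Tile) (x : ℝ) : corr (u.map Tile.bar) v x = -corr u v x := by
  induction u generalizing x with
  | nil => simp
  | cons t u ih => simp only [List.map_cons, corr, ih, weight_bar, length_bar]; ring

lemma corr_bar_right (u v : List Tile) (x : ℝ) : corr u (v.map Tile.bar) x = -corr u v x := by
  induction u generalizing x with
  | nil => simp
  | cons t u ih => simp only [corr, ih, comb_bar]; ring

lemma corr_of_span_le (u v : List Tile) {x : ℝ} (hx : span v ≤ x) : corr u v x = 0 := by
  induction u generalizing x with
  | nil => rfl
  | cons t u ih =>
    rw [corr, comb_of_span_le v hx, ih (by linarith [t.length_pos])]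
    simp

lemma corr_of_add_span_le (u v : List Tile) {x : ℝ} (hx : x + span u ≤ 0) : corr u v x = 0 := by
  induction u generalizing x with
  | nil => rfl
  | cons t u ih =>
    rw [span_cons] at hx
    rw [corr, comb_of_neg v (by linarith [t.length_pos, span_nonneg u]), ih (by linarith)]
    simp

lemma abs_weight_mul_comb_le (t : Tile) (v : List Tile) (x : ℝ) : |t.weight * comb v x| ≤ 1 := by
  rw [abs_mul, abs_weight, one_mul]
  exact abs_comb_le v x

lemma abs_corr_le_length (u v : List Tile) (x : ℝ) : |corr u v x| ≤ u.length := by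
  induction u generalizing x with
  | nil => simp
  | cons t u ih =>
    rw [corr, List.length_cons, Nat.cast_add_one, add_comm (u.length : ℝ)]
    exact (abs_add_le _ _).trans (add_le_add (abs_weight_mul_comb_le t v x) (ih _))

/-- Only the tiles of `u` to the right of the origin contribute. -/
lemma abs_corr_le_overhang_right (u v : List Tile) (x : ℝ) :
    |corr u v x| ≤ max 0 (x + span u) := by
  induction u generalizing x with
  | nil => simp
  | cons t u ih =>
    rw [span_cons]
    rcases lt_or_ge x 0 with hx | hx
    · rw [corr, comb_of_neg v hx, mul_zero, zero_add, ← add_assoc]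
      exact ih _
    · have h1 := abs_corr_le_length (t :: u) v x
      have h2 := length_le_span (t :: u)
      rw [span_cons] at h2
      exact h1.trans (le_max_of_le_right (by linarith))

/-- Only the tiles of `u` to the left of the end of `v` contribute. -/
lemma abs_corr_le_overhang_left (u v : List Tile) (x : ℝ) :
    |corr u v x| ≤ max 0 (span v - x) + 1 := by
  induction u generalizing x with
  | nil => simp; positivity
  | cons t u ih =>
    have h := abs_weight_mul_comb_le t v x
    have h1 := t.one_le_length
    rw [corr]
    rcases le_total (span v) (x + t.length) with hx | hx
    · rw [corr_of_span_le u v hx, add_zero]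
      exact h.trans (by linarith [le_max_left 0 (span v - x)])
    · refine (abs_add_le _ _).trans ?_
      have h2 := ih (x + t.length)
      rw [max_eq_right (by linarith)] at h2
      rw [max_eq_right (by linarith)]
      linarith

/-- Up to a bounded error, the autocorrelation at a fixed distance is additive under
concatenation: only pairs of tiles near the junction are not accounted for. -/
lemma abs_autocorr_append_sub_le (u v : List Tile) (z : ℝ) :
    |corr (u ++ v) (u ++ v) z - corr u u z - corr v v z| ≤ |z| + 1 := by
  have h : corr (u ++ v) (u ++ v) z - corr u u z - corr v v z
      = corr u v (z - span u) + corr v u (z + span u) := by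
    rw [corr_append_left, corr_append_right, corr_append_right, add_sub_cancel_right]
    ring
  have h1 := abs_corr_le_overhang_right u v (z - span u)
  have h2 := abs_corr_le_overhang_left v u (z + span u)
  rw [show z - span u + span u = z by ring] at h1
  rw [show span u - (z + span u) = -z by ring] at h2
  rw [h]
  refine (abs_add_le _ _).trans ?_
  rcases le_total 0 z with hz | hz
  · rw [max_eq_right hz] at h1
    rw [max_eq_left (by linarith)] at h2
    rw [abs_of_nonneg hz]
    linarith
  · rw [max_eq_left hz] at h1
    rw [max_eq_right (by linarith)] at h2
    rw [abs_of_nonpos hz]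
    linarith

/-! ### Factors of inflated words -/

lemma exists_prefix_flatMap {α β : Type*} {f : α → List β} {B : ℕ} (hf : ∀ x, (f x).length ≤ B)
    (v : List α) {w : List β} (h : w <+: v.flatMap f) :
    ∃ v' p, v' <+: v ∧ w = v'.flatMap f ++ p ∧ p.length ≤ B := by
  induction v generalizing w with
  | nil => exact ⟨[], [], List.nil_prefix, by simpa using h, by simp⟩
  | cons x v ih =>
    rw [List.flatMap_cons] at h
    rcases le_total w.length (f x).length with hl | hl
    · exact ⟨[], w, List.nil_prefix, by simp, hl.trans (hf x)⟩
    · obtain ⟨w', rfl⟩ := List.prefix_of_prefix_length_le (List.prefix_append _ _) h hl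
      obtain ⟨v', p, hv, rfl, hp⟩ := ih ((List.prefix_append_right_inj _).1 h)
      exact ⟨x :: v', p, (List.prefix_cons_inj x).2 hv, by simp, hp⟩

lemma exists_suffix_flatMap {α β : Type*} {f : α → List β} {B : ℕ} (hf : ∀ x, (f x).length ≤ B)
    (v : List α) {w : List β} (h : w <:+ v.flatMap f) :
    ∃ v' s, v' <:+ v ∧ w = s ++ v'.flatMap f ∧ s.length ≤ B := by
  induction v generalizing w with
  | nil => exact ⟨[], [], List.nil_suffix, by simpa using h, by simp⟩
  | cons x v ih =>
    rw [List.flatMap_cons] at h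
    rcases le_total w.length (v.flatMap f).length with hl | hl
    · obtain ⟨v', s, hv, hw, hs⟩ :=
        ih (List.suffix_of_suffix_length_le h (List.suffix_append _ _) hl)
      exact ⟨v', s, hv.trans (List.suffix_cons x v), hw, hs⟩
    · obtain ⟨s, rfl⟩ := List.suffix_of_suffix_length_le (List.suffix_append _ _) h hl
      obtain ⟨t, ht⟩ := h
      rw [← List.append_assoc] at ht
      refine ⟨v, s, List.suffix_cons x v, rfl, ?_⟩
      have := congrArg List.length (List.append_cancel_right ht)
      rw [List.length_append] at this
      have := hf x
      omega

/-- A factor of a concatenation of blocks is a concatenation of consecutive blocks, up to two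
incomplete blocks at its ends. -/
lemma exists_infix_flatMap {α β : Type*} {f : α → List β} {B : ℕ} (hf : ∀ x, (f x).length ≤ B)
    {v : List α} {w : List β} (h : w <:+: v.flatMap f) :
    ∃ v' s p, v' <:+: v ∧ w = s ++ v'.flatMap f ++ p ∧ s.length ≤ B ∧ p.length ≤ B := by
  obtain ⟨w', hw, hw'⟩ := List.infix_iff_prefix_suffix.1 h
  obtain ⟨v₁, s, hv₁, rfl, hs⟩ := exists_suffix_flatMap hf v hw'
  rcases le_total w.length s.length with hl | hl
  · exact ⟨[], w, [], List.nil_infix, by simp, hl.trans hs, by simp⟩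
  · obtain ⟨w₂, rfl⟩ := List.prefix_of_prefix_length_le (List.prefix_append _ _) hw hl
    obtain ⟨v', p, hv, rfl, hp⟩ :=
      exists_prefix_flatMap hf v₁ ((List.prefix_append_right_inj _).1 hw)
    exact ⟨v', s, p, hv.isInfix.trans hv₁.isInfix, by simp, hs, hp⟩

lemma Legal.infix {u w : List Tile} (hw : Legal w) (h : u <:+: w) : Legal u := by
  obtain ⟨t, n, ht⟩ := hw
  exact ⟨t, n, h.trans ht⟩

lemma legal_iterate (n : ℕ) (t : Tile) : Legal (inflateWord^[n] [t]) :=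
  ⟨t, n, List.infix_rfl⟩

/-- Every prototile occurs inside an inflated prototile, so the level of the supertile that
contains a legal word may be taken as high as desired. -/
lemma Legal.exists_infix_iterate_add {w : List Tile} (hw : Legal w) (k : ℕ) :
    ∃ t n, w <:+: inflateWord^[n + k] [t] := by
  induction k with
  | zero => exact hw
  | succ k ih =>
    obtain ⟨t, n, h⟩ := ih
    have key : ∃ (t' : Tile) (l r : List Tile), t'.inflate = l ++ [t] ++ r := by
      cases t
      exacts [⟨.bbar, [], [], rfl⟩, ⟨.a, [.a], [.abar], rfl⟩, ⟨.b, [], [], rfl⟩,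
        ⟨.abar, [.abar], [.a], rfl⟩]
    obtain ⟨t', l, r, ht⟩ := key
    refine ⟨t', n, h.trans ?_⟩
    rw [← add_assoc, Function.iterate_succ_apply, inflateWord_cons, inflateWord_nil,
      List.append_nil, ht, iterate_append, iterate_append]
    exact ⟨_, _, rfl⟩

/-- A legal word is, up to two incomplete supertiles at its ends, a sequence of level-`n`
supertiles along a legal word. -/
lemma Legal.exists_supertiles {w : List Tile} (hw : Legal w) (n : ℕ) :
    ∃ v s p, Legal v ∧ w = s ++ inflateWord^[n] v ++ p ∧
      (s.length : ℝ) ≤ longLen n ∧ (p.length : ℝ) ≤ longLen n := by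
  obtain ⟨t, m, h⟩ := hw.exists_infix_iterate_add n
  rw [add_comm, Function.iterate_add_apply, iterate_eq_flatMap n] at h
  obtain ⟨v, s, p, hv, rfl, hs, hp⟩ := exists_infix_flatMap
    (B := (inflateWord^[n] [Tile.a]).length)
    (fun x => Nat.cast_le.1 (length_iterate_singleton_le n x)) h
  refine ⟨v, s, p, (legal_iterate m t).infix hv, ?_, ?_, ?_⟩
  · rw [← iterate_eq_flatMap]
  · exact Nat.cast_le.2 hs
  · exact Nat.cast_le.2 hp

/-! ### Uniform letter frequencies -/

/-- The deviation of a word from the asymptotic ratio `λ` of long to short tiles. -/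
noncomputable def discrepancy (w : List Tile) : ℝ := longCount w - lam * shortCount w

lemma discrepancy_append (u v : List Tile) :
    discrepancy (u ++ v) = discrepancy u + discrepancy v := by
  simp only [discrepancy, longCount_append, shortCount_append]; ring

/-- The discrepancy is a left eigenvector of the inflation matrix, for the eigenvalue `-1 / λ`. -/
lemma lam_mul_discrepancy_inflateWord (w : List Tile) :
    lam * discrepancy (inflateWord w) = -discrepancy w := by
  rw [discrepancy, discrepancy, longCount_inflateWord, shortCount_inflateWord]
  linear_combination (-longCount w) * lam_sq

lemma abs_discrepancy_le (w : List Tile) : |discrepancy w| ≤ 3 * w.length := by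
  have h1 := longCount_nonneg w
  have h2 := shortCount_nonneg w
  have h3 := lam_lt_three
  have h4 := two_lt_lam
  rw [length_eq, discrepancy, abs_le]
  constructor <;> nlinarith

/-- Each inflation step contracts the discrepancy by a factor `λ > 2`, and the incomplete blocks at
the two ends add at most `18`, whence the bound `36`. -/
lemma abs_discrepancy_infix_iterate_le (n : ℕ) (t : Tile) {w : List Tile}
    (hw : w <:+: inflateWord^[n] [t]) : |discrepancy w| ≤ 36 := by
  induction n generalizing w with
  | zero =>
    have h := abs_discrepancy_le w
    have h1 : (w.length : ℝ) ≤ 1 := by exact_mod_cast hw.length_le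
    linarith
  | succ n ih =>
    rw [Function.iterate_succ_apply'] at hw
    obtain ⟨v, s, p, hv, rfl, hs, hp⟩ :=
      exists_infix_flatMap (B := 3) (by intro x; cases x <;> simp [Tile.inflate]) hw
    have h1 := (abs_discrepancy_le s).trans
      (mul_le_mul_of_nonneg_left (by exact_mod_cast hs : (s.length : ℝ) ≤ 3) (by norm_num))
    have h2 := (abs_discrepancy_le p).trans
      (mul_le_mul_of_nonneg_left (by exact_mod_cast hp : (p.length : ℝ) ≤ 3) (by norm_num))
    have h3 : |discrepancy (inflateWord v)| ≤ 18 := by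
      have h4 := ih hv
      have h5 := two_lt_lam
      rw [← abs_neg, ← lam_mul_discrepancy_inflateWord, abs_mul, abs_of_pos (by linarith)] at h4
      nlinarith [abs_nonneg (discrepancy (inflateWord v))]
    rw [discrepancy_append, discrepancy_append]
    change |discrepancy s + discrepancy (inflateWord v) + discrepancy p| ≤ 36
    rw [abs_le] at *
    constructor <;> linarith [h1.1, h1.2, h2.1, h2.2, h3.1, h3.2]

lemma Legal.abs_discrepancy_le {w : List Tile} (hw : Legal w) : |discrepancy w| ≤ 36 := by
  obtain ⟨t, n, h⟩ := hw
  exact abs_discrepancy_infix_iterate_le n t h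

/-! ### Uniform means of almost additive functionals -/

section AlmostAdditive

variable {F : List Tile → ℝ} {c : ℝ}

/-- `ν` is the mean of `F` per letter, uniformly over all legal words. -/
def IsUniformMean (F : List Tile → ℝ) (ν : ℝ) : Prop :=
  ∀ ε > 0, ∃ K : ℝ, ∀ w, Legal w → |F w - ν * w.length| ≤ ε * w.length + K

lemma abs_iterate_sub_le (h0 : F [] = 0) (hadd : ∀ u v, |F (u ++ v) - F u - F v| ≤ c)
    (hbar : ∀ u, F (u.map Tile.bar) = F u) (n : ℕ) (v : List Tile) :
    |F (inflateWord^[n] v) - (longCount v * F (inflateWord^[n] [.a])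
      + shortCount v * F (inflateWord^[n] [.b]))| ≤ c * v.length := by
  induction v with
  | nil => simp [h0]
  | cons t v ih =>
    have hs : F (inflateWord^[n] [t]) = t.long * F (inflateWord^[n] [.a])
        + t.short * F (inflateWord^[n] [.b]) := by
      have h1 := iterate_bar n [.a]
      have h2 := iterate_bar n [.b]
      simp only [List.map_cons, List.map_nil, Tile.bar] at h1 h2
      cases t <;> simp [Tile.long, Tile.short, h1, h2, hbar]
    have h := hadd (inflateWord^[n] [t]) (inflateWord^[n] v)
    rw [iterate_cons, longCount_cons, shortCount_cons, List.length_cons, Nat.cast_add_one]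
    rw [abs_le] at *
    constructor <;> linarith [h.1, h.2, ih.1, ih.2]

/-- Cutting a legal word into level-`n` supertiles determines the mean up to `c / shortLen n`,
because the letter frequencies in legal words are uniform. -/
lemma exists_approx_mean (h0 : F [] = 0) (hadd : ∀ u v, |F (u ++ v) - F u - F v| ≤ c)
    (hbar : ∀ u, F (u.map Tile.bar) = F u) (hle : ∀ u, |F u| ≤ u.length) (n : ℕ) :
    ∃ ν K : ℝ, ∀ w, Legal w → |F w - ν * w.length| ≤ c / shortLen n * w.length + K := by
  have hc : 0 ≤ c := (abs_nonneg _).trans (hadd [] [])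
  set A := longLen n with hA
  set B := shortLen n with hB
  have hBA : B ≤ A := shortLen_le_longLen n
  have hB1 : 1 ≤ B := (le_shortLen n).2
  have hl := two_lt_lam
  set α := F (inflateWord^[n] [.a])
  set β := F (inflateWord^[n] [.b])
  have hα : |α| ≤ A := hle _
  have hβ : |β| ≤ B := hle _
  have hpos : 0 < lam * A + B := by nlinarith
  -- the mean over a word of supertiles in which the ratio of long to short ones is exactly `λ`
  set ν := (lam * α + β) / (lam * A + B) with hν
  have hνeq : ν * (lam * A + B) = lam * α + β := div_mul_cancel₀ _ hpos.ne'
  have hν1 : |ν| ≤ 1 := by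
    rw [hν, abs_div, abs_of_pos hpos, div_le_one hpos]
    refine (abs_add_le _ _).trans (add_le_add ?_ hβ)
    rw [abs_mul, abs_of_pos (by linarith)]
    exact mul_le_mul_of_nonneg_left hα (by linarith)
  refine ⟨ν, 2 * c + 4 * A + 72 * A, fun w hw => ?_⟩
  obtain ⟨v, s, p, hv, rfl, hs, hp⟩ := hw.exists_supertiles n
  have hlen := length_iterate n v
  rw [← hA, ← hB] at hlen
  set V := inflateWord^[n] v with hV
  have e1 : |F (s ++ V ++ p) - F V| ≤ 2 * c + 2 * A := by
    have a1 := hadd (s ++ V) p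
    have a2 := hadd s V
    have a3 := (hle s).trans hs
    have a4 := (hle p).trans hp
    rw [abs_le] at *
    constructor <;> linarith [a1.1, a1.2, a2.1, a2.2, a3.1, a3.2, a4.1, a4.2]
  have e2 : |F V - (longCount v * α + shortCount v * β)| ≤ c * v.length :=
    abs_iterate_sub_le h0 hadd hbar n v
  have e3 : |(longCount v * α + shortCount v * β) - ν * V.length| ≤ 72 * A := by
    have : (longCount v * α + shortCount v * β) - ν * V.length
        = discrepancy v * (α - ν * A) := by
      rw [hlen, discrepancy]
      linear_combination (-shortCount v) * hνeq
    rw [this, abs_mul]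
    have h1 : |α - ν * A| ≤ 2 * A := by
      refine (abs_sub _ _).trans ?_
      rw [abs_mul, abs_of_nonneg (by linarith : 0 ≤ A)]
      nlinarith
    calc |discrepancy v| * |α - ν * A| ≤ 36 * (2 * A) :=
          mul_le_mul hv.abs_discrepancy_le h1 (abs_nonneg _) (by norm_num)
      _ = 72 * A := by ring
  have hwlen : ((s ++ V ++ p).length : ℝ) = s.length + V.length + p.length := by
    push_cast [List.length_append]; ring
  have e4 : |ν * V.length - ν * (s ++ V ++ p).length| ≤ 2 * A := by
    rw [← mul_sub, abs_mul, hwlen]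
    have : |(V.length : ℝ) - (s.length + V.length + p.length)| ≤ 2 * A := by
      have h1 : (0 : ℝ) ≤ s.length := Nat.cast_nonneg _
      have h2 : (0 : ℝ) ≤ p.length := Nat.cast_nonneg _
      rw [abs_le]
      constructor <;> linarith
    nlinarith [abs_nonneg ((V.length : ℝ) - (s.length + V.length + p.length))]
  have e5 : c * v.length ≤ c / B * (s ++ V ++ p).length := by
    rw [div_mul_eq_mul_div, mul_div_assoc]
    refine mul_le_mul_of_nonneg_left ?_ hc
    rw [le_div_iff₀ (by linarith), hwlen, hlen, length_eq]
    have h1 : (0 : ℝ) ≤ s.length := Nat.cast_nonneg _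
    have h2 : (0 : ℝ) ≤ p.length := Nat.cast_nonneg _
    nlinarith [longCount_nonneg v]
  rw [abs_le] at *
  constructor <;> linarith [e1.1, e1.2, e2.1, e2.2, e3.1, e3.2, e4.1, e4.2]

lemma tendsto_shortLen : Tendsto shortLen atTop atTop :=
  tendsto_atTop_mono (fun n => (le_shortLen n).1) tendsto_natCast_atTop_atTop

lemma tendsto_longLen : Tendsto longLen atTop atTop :=
  tendsto_atTop_mono shortLen_le_longLen tendsto_shortLen

lemma IsUniformMean.tendsto {ν : ℝ} (h : IsUniformMean F ν) {ι : Type*} {l : Filter ι}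
    {w : ι → List Tile} (hw : ∀ i, Legal (w i))
    (hlen : Tendsto (fun i => ((w i).length : ℝ)) l atTop) :
    Tendsto (fun i => F (w i) / (w i).length) l (𝓝 ν) := by
  rw [Metric.tendsto_nhds]
  intro ε hε
  obtain ⟨K, hK⟩ := h (ε / 2) (half_pos hε)
  filter_upwards [hlen.eventually_gt_atTop 0, hlen.eventually_gt_atTop (2 * K / ε)] with i h0 h1
  rw [div_lt_iff₀ hε] at h1
  rw [Real.dist_eq, div_sub' h0.ne', abs_div, abs_of_pos h0, div_lt_iff₀ h0, mul_comm _ ν]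
  linarith [hK _ (hw i)]

theorem exists_isUniformMean (h0 : F [] = 0) (hadd : ∀ u v, |F (u ++ v) - F u - F v| ≤ c)
    (hbar : ∀ u, F (u.map Tile.bar) = F u) (hle : ∀ u, |F u| ≤ u.length) :
    ∃ ν, IsUniformMean F ν := by
  have happrox : ∀ ε > 0, ∃ ν K : ℝ, ∀ w, Legal w → |F w - ν * w.length| ≤ ε * w.length + K := by
    intro ε hε
    obtain ⟨n, hn⟩ := (tendsto_shortLen.eventually_ge_atTop (c / ε)).exists
    obtain ⟨ν, K, h⟩ := exists_approx_mean h0 hadd hbar hle n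
    refine ⟨ν, K, fun w hw => (h w hw).trans ?_⟩
    have hB := (le_shortLen n).2
    have : c / shortLen n ≤ ε := by
      rw [div_le_iff₀ hε] at hn
      rw [div_le_iff₀ (by linarith)]
      linarith
    gcongr
  -- the means over the inflated long tiles form a Cauchy sequence
  set x : ℕ → ℝ := fun m => F (inflateWord^[m] [.a]) / longLen m
  have hx : ∀ ε > 0, ∃ ν K : ℝ, (∀ w, Legal w → |F w - ν * w.length| ≤ ε * w.length + K) ∧
      ∀ᶠ m in atTop, |x m - ν| ≤ 2 * ε := by
    intro ε hε
    obtain ⟨ν, K, h⟩ := happrox ε hε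
    refine ⟨ν, K, h, ?_⟩
    filter_upwards [tendsto_longLen.eventually_gt_atTop 0,
      tendsto_longLen.eventually_gt_atTop (K / ε)] with m h1 h2
    have h3 := h _ (legal_iterate m .a)
    change |_ - ν * longLen m| ≤ ε * longLen m + K at h3
    rw [div_lt_iff₀ hε] at h2
    simp only [x]
    rw [div_sub' h1.ne', abs_div, abs_of_pos h1, div_le_iff₀ h1, mul_comm _ ν]
    linarith
  have hcau : CauchySeq x := by
    rw [Metric.cauchySeq_iff']
    intro ε hε
    obtain ⟨ν, K, -, h⟩ := hx (ε / 5) (by positivity)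
    obtain ⟨N, hN⟩ := eventually_atTop.1 h
    refine ⟨N, fun n hn => ?_⟩
    have h1 := abs_le.1 (hN n hn)
    have h2 := abs_le.1 (hN N le_rfl)
    rw [Real.dist_eq, abs_lt]
    constructor <;> linarith [h1.1, h1.2, h2.1, h2.2]
  obtain ⟨ν, hν⟩ := cauchySeq_tendsto_of_complete hcau
  refine ⟨ν, fun ε hε => ?_⟩
  obtain ⟨ν', K, h, h'⟩ := hx (ε / 3) (by positivity)
  have hd : |ν - ν'| ≤ 2 * (ε / 3) :=
    le_of_tendsto ((hν.sub_const ν').abs) h'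
  refine ⟨K, fun w hw => ?_⟩
  have h1 := h w hw
  have h2 : |(ν - ν') * w.length| ≤ 2 * (ε / 3) * w.length := by
    rw [abs_mul, Nat.abs_cast]
    gcongr
  rw [abs_le] at *
  constructor <;> linarith [h1.1, h1.2, h2.1, h2.2]

end AlmostAdditive

theorem exists_isUniformMean_autocorr (z : ℝ) :
    ∃ ν, IsUniformMean (fun w => corr w w z) ν :=
  exists_isUniformMean (c := |z| + 1) (by simp) (fun u v => abs_autocorr_append_sub_le u v z)
    (fun u => by rw [corr_bar_left, corr_bar_right, neg_neg]) (fun u => abs_corr_le_length u u z)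

/-! ### Tilings and words -/

/-- The word of `n` consecutive tiles of `T` that starts with the tile of index `i`. -/
def Tiling.window (T : Tiling) (i : ℤ) (n : ℕ) : List Tile :=
  (List.range n).map fun k : ℕ => T.tile (i + k)

namespace Tiling

variable (T : Tiling)

lemma window_succ (i : ℤ) (n : ℕ) : T.window i (n + 1) = T.window i n ++ [T.tile (i + n)] := by
  simp [window, List.range_succ]

lemma length_window (i : ℤ) (n : ℕ) : (T.window i n).length = n := by
  simp [window]

lemma span_window (i : ℤ) (n : ℕ) : span (T.window i n) = T.left (i + n) - T.left i := by
  induction n with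
  | zero => simp [window]
  | succ n ih =>
    rw [window_succ, span_append, ih]
    push_cast
    rw [← add_assoc, T.left_succ]
    simp
    ring

lemma comb_window (i : ℤ) (n : ℕ) (x : ℝ) :
    comb (T.window i n) x
      = ∑ k ∈ Finset.range n,
          if T.left (i + k) - T.left i = x then (T.tile (i + k)).weight else 0 := by
  induction n with
  | zero => simp [window, comb]
  | succ n ih =>
    rw [window_succ, comb_append, ih, Finset.sum_range_succ, span_window]
    simp only [comb, add_zero, sub_eq_zero, eq_comm (a := x)]

lemma corr_window (i : ℤ) (n : ℕ) (v : List Tile) (x : ℝ) :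
    corr (T.window i n) v x
      = ∑ k ∈ Finset.range n, (T.tile (i + k)).weight * comb v (x + (T.left (i + k) - T.left i)) := by
  induction n with
  | zero => simp [window]
  | succ n ih =>
    rw [window_succ, corr_append_left, ih, Finset.sum_range_succ, span_window]
    simp [corr]

/-- In the definition of `hull`, the index list is first mapped from `ℕ` to `ℤ`; `window` performs
the cast inside the mapped function. -/
lemma mem_hull_iff : T ∈ hull ↔ ∀ i n, Legal (T.window i n) := by
  have h : ∀ (i : ℤ) (n : ℕ), ((List.range n >>= fun a => pure (a : ℤ)).map fun k => T.tile (i + k))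
      = T.window i n := fun i n => by
    rw [bind_pure_comp, List.map_eq_map, List.map_map]
    rfl
  exact forall₂_congr fun i n => by rw [← h i n]

lemma mem_pointsIn {R x : ℝ} : x ∈ T.pointsIn R ↔ x ∈ T.points ∧ -R < x ∧ x < R := by
  simp [pointsIn]

/-- The points of `T` in `(-R, R)` are the left endpoints of consecutive tiles. -/
lemma exists_pointsIn_eq (R : ℝ) :
    ∃ (i : ℤ) (n : ℕ), T.pointsIn R = (Finset.range n).image fun k : ℕ => T.left (i + k) := by
  classical
  rcases (T.pointsIn R).eq_empty_or_nonempty with h | h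
  · exact ⟨0, 0, by simp [h]⟩
  obtain ⟨i, hi⟩ := ((T.mem_pointsIn).1 ((T.pointsIn R).min'_mem h)).1
  obtain ⟨j, hj⟩ := ((T.mem_pointsIn).1 ((T.pointsIn R).max'_mem h)).1
  refine ⟨i, (j + 1 - i).toNat, ?_⟩
  ext x
  simp only [Finset.mem_image, Finset.mem_range]
  constructor
  · intro hx
    obtain ⟨⟨k, rfl⟩, -⟩ := (T.mem_pointsIn).1 hx
    have h1 : i ≤ k := T.left_strictMono.le_iff_le.1 (hi ▸ Finset.min'_le _ _ hx)
    have h2 : k ≤ j := T.left_strictMono.le_iff_le.1 (hj ▸ Finset.le_max' _ _ hx)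
    exact ⟨(k - i).toNat, by omega, by congr 1; omega⟩
  · rintro ⟨k, hk, rfl⟩
    have h1 := ((T.mem_pointsIn).1 ((T.pointsIn R).min'_mem h)).2.1
    have h2 := ((T.mem_pointsIn).1 ((T.pointsIn R).max'_mem h)).2.2
    rw [← hi] at h1
    rw [← hj] at h2
    exact (T.mem_pointsIn).2 ⟨⟨_, rfl⟩, h1.trans_le (T.left_strictMono.monotone (by omega)),
      (T.left_strictMono.monotone (by omega)).trans_lt h2⟩

/-- The finite-size autocorrelation of a tiling is that of the word it shows in `(-R, R)`. -/
lemma exists_autocorr_eq (R : ℝ) :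
    ∃ (i : ℤ) (n : ℕ), (T.pointsIn R).card = n ∧
      ∀ z, T.autocorr z R = corr (T.window i n) (T.window i n) z / n := by
  classical
  obtain ⟨i, n, h⟩ := T.exists_pointsIn_eq R
  have hinj : Set.InjOn (fun k : ℕ => T.left (i + k)) (Finset.range n : Set ℕ) := by
    intro k _ l _ hkl
    have := T.left_strictMono.injective hkl
    omega
  have hcard : (T.pointsIn R).card = n := by
    rw [h, Finset.card_image_of_injOn hinj, Finset.card_range]
  refine ⟨i, n, hcard, fun z => ?_⟩
  rw [autocorr, hcard, one_div_mul_eq_div, corr_window, Finset.sum_filter, Finset.sum_product_right,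
    h, Finset.sum_image hinj]
  congr 1
  refine Finset.sum_congr rfl fun k _ => ?_
  rw [Finset.sum_image hinj, comb_window, Finset.mul_sum]
  refine Finset.sum_congr rfl fun l _ => ?_
  have : T.left (i + l) - T.left (i + k) = z
      ↔ T.left (i + l) - T.left i = z + (T.left (i + k) - T.left i) := by
    constructor <;> intro h <;> linarith
  simp only [this, w_left]
  split_ifs <;> ring

lemma tendsto_card_pointsIn : Tendsto (fun R => ((T.pointsIn R).card : ℝ)) atTop atTop := by
  classical
  refine tendsto_natCast_atTop_atTop.comp (tendsto_atTop.2 fun n => ?_)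
  filter_upwards [eventually_gt_atTop |T.left 0|, eventually_gt_atTop |T.left n|] with R h1 h2
  have hinj : Function.Injective fun k : ℕ => T.left k := fun k l hkl => by
    exact_mod_cast T.left_strictMono.injective hkl
  have hsub : (Finset.range n).image (fun k : ℕ => T.left k) ⊆ T.pointsIn R := by
    intro x hx
    obtain ⟨k, hk, rfl⟩ := Finset.mem_image.1 hx
    rw [Finset.mem_range] at hk
    have h3 : T.left 0 ≤ T.left k := T.left_strictMono.monotone (by omega)
    have h4 : T.left k ≤ T.left n := T.left_strictMono.monotone (by omega)
    exact (T.mem_pointsIn).2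
      ⟨⟨_, rfl⟩, by linarith [(abs_lt.1 h1).1], by linarith [(abs_lt.1 h2).2]⟩
  simpa [Finset.card_image_of_injective _ hinj] using Finset.card_le_card hsub

end Tiling

lemma isAutocorrelation_of_isUniformMean {ν : ℝ → ℝ}
    (h : ∀ z, IsUniformMean (fun w => corr w w z) (ν z)) : IsAutocorrelation ν := by
  intro T hT z
  choose i n hn h' using T.exists_autocorr_eq
  have := (h z).tendsto (l := atTop) (w := fun R => T.window (i R) (n R))
    (fun R => T.mem_hull_iff.1 hT _ _) (by
      simpa only [Tiling.length_window, ← hn] using T.tendsto_card_pointsIn)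
  simpa only [h', Tiling.length_window] using this

/-! ### Existence of tilings in the hull -/

/-- A bi-infinite sequence of tiles, laid out on the line. -/
noncomputable def Tiling.ofTiles (x : ℤ → Tile) : Tiling where
  tile := x
  left i := ∑ k ∈ Finset.Ico 0 i, (x k).length - ∑ k ∈ Finset.Ico i 0, (x k).length
  left_succ i := by
    rcases le_or_gt 0 i with hi | hi
    · rw [Finset.Ico_eq_empty_of_le (show (0 : ℤ) ≤ i + 1 by omega), Finset.Ico_eq_empty_of_le hi,
        ← Finset.insert_Ico_right_eq_Ico_add_one hi, Finset.sum_insert (by simp)]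
      simp
      ring
    · rw [Finset.Ico_eq_empty_of_le (show i + 1 ≤ 0 by omega), Finset.Ico_eq_empty_of_le hi.le,
        ← Finset.insert_Ico_add_one_left_eq_Ico hi, Finset.sum_insert (by simp)]
      simp

instance : Finite Tile :=
  Finite.of_surjective (fun p : Bool × Bool => match p with
    | (true, true) => Tile.a
    | (true, false) => Tile.b
    | (false, true) => Tile.abar
    | (false, false) => Tile.bbar) fun t => by
      cases t
      exacts [⟨(true, true), rfl⟩, ⟨(true, false), rfl⟩, ⟨(false, true), rfl⟩,
        ⟨(false, false), rfl⟩]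

lemma exists_legal_length (n : ℕ) : ∃ w, Legal w ∧ w.length = n := by
  obtain ⟨m, hm⟩ := (tendsto_longLen.eventually_ge_atTop (n : ℝ)).exists
  refine ⟨(inflateWord^[m] [.a]).take n,
    (legal_iterate m .a).infix (List.take_prefix _ _).isInfix, ?_⟩
  rw [List.length_take, min_eq_left]
  exact Nat.cast_le.1 hm

/-- By compactness, there is a bi-infinite sequence all of whose central windows are legal. -/
theorem hull_nonempty : hull.Nonempty := by
  let : TopologicalSpace Tile := ⊥
  have : DiscreteTopology Tile := ⟨rfl⟩
  -- the word on the tiles with indices in `[-n, n)`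
  let W : ℕ → (ℤ → Tile) → List Tile := fun n x => List.ofFn fun k : Fin (2 * n) => x (-n + k)
  have hW : ∀ (n : ℕ) x (i : ℤ) (m : ℕ), -(n : ℤ) ≤ i → i + m ≤ n →
      ((List.range m).map fun k => x (i + k)) <:+: W n x := by
    intro n x i m h1 h2
    obtain ⟨j, hj⟩ := Int.eq_ofNat_of_zero_le (show 0 ≤ i + n by omega)
    refine List.infix_iff_prefix_suffix.2 ⟨(W n x).drop j, ?_, List.drop_suffix _ _⟩
    rw [List.prefix_iff_eq_take]
    apply List.ext_getElem
    · simp [W]; omega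
    · intro k h3 h4
      simp only [List.getElem_map, List.getElem_range, List.getElem_take, List.getElem_drop, W,
        List.getElem_ofFn]
      congr 1
      push_cast
      omega
  let S : ℕ → Set (ℤ → Tile) := fun n => {x | Legal (W n x)}
  have hS : (⋂ n, S n).Nonempty := by
    have hclosed : ∀ n, IsClosed (S n) := fun n =>
      (isClosed_discrete {y : Fin (2 * n) → Tile | Legal (List.ofFn y)}).preimage
        (f := fun (x : ℤ → Tile) (k : Fin (2 * n)) => x (-n + k))
        (continuous_pi fun k => continuous_apply _)
    refine IsCompact.nonempty_iInter_of_sequence_nonempty_isCompact_isClosed S ?_ ?_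
      (hclosed 0).isCompact hclosed
    · intro n x hx
      refine Legal.infix hx ?_
      have := hW (n + 1) x (-n) (2 * n) (by push_cast; omega) (by push_cast; omega)
      have h : W n x = (List.range (2 * n)).map fun k : ℕ => x (-n + k) :=
        List.ext_getElem (by simp [W]) (by simp [W])
      rwa [h]
    · intro n
      obtain ⟨w, hw, hl⟩ := exists_legal_length (2 * n)
      refine ⟨fun i => w.getD (i + n).toNat .a, ?_⟩
      have : W n (fun i => w.getD (i + n).toNat .a) = w := by
        apply List.ext_getElem
        · simp [W, hl]
        · intro k h1 h2
          simp [W, h2]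
      change Legal _
      rwa [this]
  obtain ⟨x, hx⟩ := hS
  refine ⟨Tiling.ofTiles x, (Tiling.mem_hull_iff _).2 fun i n => ?_⟩
  have h := Set.mem_iInter.1 hx (i.natAbs + n)
  refine Legal.infix h ?_
  exact hW (i.natAbs + n) x i n (by omega) (by omega)

/-! ### Balanced pairs of words -/

/-- The correlation at displacement zero of the `n`-fold inflations of two words. -/
noncomputable def overlap (n : ℕ) (u v : List Tile) : ℝ :=
  corr (inflateWord^[n] u) (inflateWord^[n] v) 0

lemma overlap_bar_left (n : ℕ) (u v : List Tile) :
    overlap n (u.map Tile.bar) v = -overlap n u v := by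
  rw [overlap, iterate_bar, corr_bar_left, overlap]

lemma overlap_bar_right (n : ℕ) (u v : List Tile) :
    overlap n u (v.map Tile.bar) = -overlap n u v := by
  rw [overlap, iterate_bar, corr_bar_right, overlap]

/-- Words of equal geometric length keep this property under inflation, so there are no
coincidences between the first part of either row and the second part of the other. -/
lemma overlap_append (n : ℕ) {u₁ v₁ : List Tile} (h : span u₁ = span v₁) (u₂ v₂ : List Tile) :
    overlap n (u₁ ++ u₂) (v₁ ++ v₂) = overlap n u₁ v₁ + overlap n u₂ v₂ := by
  have h' : span (inflateWord^[n] u₁) = span (inflateWord^[n] v₁) := by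
    rw [span_iterate, span_iterate, h]
  simp only [overlap, iterate_append]
  rw [corr_append_left, corr_append_right, corr_append_right, zero_add, zero_sub, h', sub_self,
    corr_of_add_span_le (inflateWord^[n] u₁) (inflateWord^[n] v₂) (by rw [h', neg_add_cancel]),
    corr_of_span_le _ _ le_rfl, add_zero, zero_add]

lemma corr_self_zero (u : List Tile) : corr u u 0 = u.length := by
  induction u with
  | nil => simp
  | cons t u ih =>
    have h1 : corr (t :: u) (t :: u) 0 = corr [t] [t] 0 + corr u u 0 := by
      have := overlap_append 0 (u₁ := [t]) rfl u u
      simpa [overlap] using this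
    rw [h1, ih]
    simp [corr, comb, weight_mul_self]
    ring

lemma overlap_a_a (n : ℕ) : overlap n [.a] [.a] = longLen n := corr_self_zero _

lemma overlap_abar_abar (n : ℕ) : overlap n [.abar] [.abar] = longLen n := by
  have := overlap_bar_left n [.a] [.abar]
  have h := overlap_bar_right n [.a] [.a]
  simp only [List.map_cons, List.map_nil, Tile.bar, overlap_a_a] at this h
  rw [this, h, neg_neg]

lemma overlap_a_abar (n : ℕ) : overlap n [.a] [.abar] = -longLen n := by
  simpa [Tile.bar, overlap_a_a] using overlap_bar_right n [.a] [.a]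

lemma overlap_abar_a (n : ℕ) : overlap n [.abar] [.a] = -longLen n := by
  simpa [Tile.bar, overlap_a_a] using overlap_bar_left n [.a] [.a]

/-- The closed form of the overlap of the two orders of a long and a short supertile. -/
noncomputable def swapOverlap (n : ℕ) : ℝ := shortLen n - longLen n + (-1) ^ n

/-- Inflating one of the two balanced pairs gives two pairs of long tiles of opposite sign and
the negative of the other balanced pair. -/
lemma overlap_ab_b_abar (n : ℕ) :
    overlap n [.a, .b] [.b, .abar] = swapOverlap n ∧
      overlap n [.b, .abar] [.a, .b] = swapOverlap n := by
  have hl := two_lt_lam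
  have h1 : lam ≠ 1 := by linarith
  have h0 : lam ≠ 0 := by linarith
  induction n with
  | zero =>
    constructor
    · simp [overlap, corr, comb, swapOverlap, longLen_zero, shortLen_zero, Tile.weight,
        Tile.length, h0, h1, sub_eq_zero]
    · simp [overlap, corr, comb, swapOverlap, longLen_zero, shortLen_zero, Tile.weight,
        Tile.length, h0, h1.symm, sub_eq_zero]
  | succ n ih =>
    obtain ⟨ih1, ih2⟩ := ih
    have b1 : overlap n [.abar, .bbar] [.b, .abar] = -swapOverlap n := by
      rw [← ih1]; exact overlap_bar_left n [.a, .b] [.b, .abar]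
    have b2 : overlap n [.b, .abar] [.abar, .bbar] = -swapOverlap n := by
      rw [← ih2]; exact overlap_bar_right n [.b, .abar] [.a, .b]
    have e : -2 * longLen n - swapOverlap n = swapOverlap (n + 1) := by
      rw [swapOverlap, swapOverlap, longLen_succ, shortLen_succ, pow_succ]; ring
    constructor
    · calc overlap (n + 1) [.a, .b] [.b, .abar]
          = overlap n ([.a] ++ ([.b, .abar] ++ [.abar])) ([.abar] ++ ([.abar, .bbar] ++ [.a])) := rfl
        _ = swapOverlap (n + 1) := by
          rw [overlap_append n (by simp [Tile.length]), overlap_append n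
            (by simp [Tile.length]; ring), overlap_a_abar, overlap_abar_a, b2, ← e]
          ring
    · calc overlap (n + 1) [.b, .abar] [.a, .b]
          = overlap n ([.abar] ++ ([.abar, .bbar] ++ [.a])) ([.a] ++ ([.b, .abar] ++ [.abar])) := rfl
        _ = swapOverlap (n + 1) := by
          rw [overlap_append n (by simp [Tile.length]), overlap_append n
            (by simp [Tile.length]; ring), overlap_a_abar, overlap_abar_a, b1, ← e]
          ring

/-- A short supertile moved across two long ones of equal sign. -/
lemma overlap_b_abar_abar (n : ℕ) :
    overlap (n + 1) [.b, .abar, .abar] [.abar, .abar, .bbar]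
      = longLen n + 2 * swapOverlap n := by
  have b1 : overlap n [.abar, .bbar] [.bbar, .a] = swapOverlap n := by
    have h1 := overlap_bar_left n [.a, .b] [.bbar, .a]
    have h2 := overlap_bar_right n [.a, .b] [.b, .abar]
    simp only [List.map_cons, List.map_nil, Tile.bar, (overlap_ab_b_abar n).1] at h1 h2
    rw [h1, h2, neg_neg]
  calc overlap (n + 1) [.b, .abar, .abar] [.abar, .abar, .bbar]
      = overlap n ([.abar] ++ ([.abar, .bbar] ++ ([.a] ++ ([.abar, .bbar] ++ [.a]))))
          ([.abar] ++ ([.bbar, .a] ++ ([.abar] ++ ([.bbar, .a] ++ [.a])))) := rfl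
    _ = longLen n + 2 * swapOverlap n := by
      rw [overlap_append n rfl, overlap_append n (by simp [Tile.length]; ring),
        overlap_append n (by simp [Tile.length]), overlap_append n (by simp [Tile.length]; ring),
        b1, overlap_abar_abar, overlap_a_abar, overlap_a_a]
      ring

/-! ### Words with the local sign pattern of the inflation -/

/-- Words that begin and end with a long tile and in which every short tile is preceded by a long
tile of the same sign and followed by a long tile of the opposite sign. -/
inductive Patterned : List Tile → Prop
  | a : Patterned [.a]
  | abar : Patterned [.abar]
  | cons_a {w} (h : Patterned w) : Patterned (.a :: w)
  | cons_abar {w} (h : Patterned w) : Patterned (.abar :: w)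
  | cons_ab {w} (h : Patterned (.abar :: w)) : Patterned (.a :: .b :: .abar :: w)
  | cons_abar_bbar {w} (h : Patterned (.a :: w)) : Patterned (.abar :: .bbar :: .a :: w)

lemma Patterned.exists_cons {w : List Tile} (h : Patterned w) :
    ∃ v, w = .a :: v ∨ w = .abar :: v := by
  cases h
  exacts [⟨_, .inl rfl⟩, ⟨_, .inr rfl⟩, ⟨_, .inl rfl⟩, ⟨_, .inr rfl⟩, ⟨_, .inl rfl⟩, ⟨_, .inr rfl⟩]

lemma Patterned.inflated {w : List Tile} (h : Patterned w) : Patterned (inflateWord w) := by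
  induction h with
  | a => exact .cons_ab .abar
  | abar => exact .cons_abar_bbar .a
  | cons_a h ih => exact .cons_ab (.cons_abar ih)
  | cons_abar h ih => exact .cons_abar_bbar (.cons_a ih)
  | cons_ab h ih => exact .cons_ab (.cons_abar (.cons_abar ih))
  | cons_abar_bbar h ih => exact .cons_abar_bbar (.cons_a (.cons_a ih))

lemma patterned_iterate (m : ℕ) : Patterned (inflateWord^[m] [.a]) := by
  induction m with
  | zero => exact .a
  | succ m ih => rw [Function.iterate_succ_apply']; exact ih.inflated

/-- The sum, over all pairs of adjacent long tiles, of the products of their weights. -/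
noncomputable def adjacency : List Tile → ℝ
  | x :: y :: w => x.long * y.long * (x.weight * y.weight) + adjacency (y :: w)
  | _ => 0

/-- Adjacent long tiles in an inflated word stem from the junctions of the inflated tiles: each of
the two junctions at an inflated short tile contributes `1`, and the others reverse the sign. -/
lemma Patterned.adjacency_inflateWord {w : List Tile} (h : Patterned w) :
    adjacency (inflateWord w) = -adjacency w + 2 * shortCount w := by
  induction h with
  | a => simp [Tile.inflate, adjacency, Tile.long, Tile.short]
  | abar => simp [Tile.inflate, adjacency, Tile.long, Tile.short]
  | cons_a h ih =>
    obtain ⟨v, rfl | rfl⟩ := h.exists_cons <;>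
    · simp [Tile.inflate, adjacency, Tile.long, Tile.short, Tile.weight] at ih ⊢
      linarith
  | cons_abar h ih =>
    obtain ⟨v, rfl | rfl⟩ := h.exists_cons <;>
    · simp [Tile.inflate, adjacency, Tile.long, Tile.short, Tile.weight] at ih ⊢
      linarith
  | cons_ab h ih =>
    simp [Tile.inflate, adjacency, Tile.long, Tile.short, Tile.weight] at ih ⊢
    linarith
  | cons_abar_bbar h ih =>
    simp [Tile.inflate, adjacency, Tile.long, Tile.short, Tile.weight] at ih ⊢
    linarith

lemma adjacency_iterate (m : ℕ) :
    adjacency (inflateWord^[m] [.a])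
      = 3 * shortCount (inflateWord^[m] [.a]) - longCount (inflateWord^[m] [.a]) + (-1) ^ m := by
  induction m with
  | zero => simp [adjacency, Tile.long, Tile.short]
  | succ m ih =>
    rw [Function.iterate_succ_apply', (patterned_iterate m).adjacency_inflateWord, ih,
      longCount_inflateWord, shortCount_inflateWord, pow_succ]
    ring

/-- The overlap of the inflation of a patterned word with itself, displaced by one long and one
short supertile. Each long tile of `w` contributes a pair of long supertiles of opposite sign,
and the gap to the next long tile of `w` contributes one of the balanced pairs. -/
lemma Patterned.overlap_drop {w : List Tile} (h : Patterned w) (n : ℕ) :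
    overlap (n + 1) (inflateWord w) ((inflateWord w).drop 2)
      = -longCount w * longLen (n + 1) + shortCount w * (longLen n + 2 * swapOverlap n)
        + adjacency w * swapOverlap (n + 1) := by
  have hX := (overlap_ab_b_abar (n + 1)).2
  have hZ := overlap_b_abar_abar n
  -- the values of the balanced pairs for all choices of signs
  have hX' : overlap (n + 1) [.bbar, .a] [.a, .b] = -swapOverlap (n + 1) := by
    rw [← hX]; exact overlap_bar_left (n + 1) [.b, .abar] [.a, .b]
  have hX₂ : overlap (n + 1) [.b, .abar] [.abar, .bbar] = -swapOverlap (n + 1) := by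
    rw [← hX]; exact overlap_bar_right (n + 1) [.b, .abar] [.a, .b]
  have hX₃ : overlap (n + 1) [.bbar, .a] [.abar, .bbar] = swapOverlap (n + 1) := by
    rw [← neg_neg (swapOverlap (n + 1)), ← hX']
    exact overlap_bar_right (n + 1) [.bbar, .a] [.a, .b]
  have hZ' : overlap (n + 1) [.bbar, .a, .a] [.a, .a, .b] = longLen n + 2 * swapOverlap n := by
    rw [← hZ, ← neg_neg (overlap (n + 1) [.b, .abar, .abar] _), ← overlap_bar_left,
      ← overlap_bar_right]
    rfl
  have hnil : ∀ u, overlap (n + 1) u [] = 0 := fun u => by simp [overlap]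
  have hsingle : ∀ (x y : Tile) (u : List Tile), x.length = y.length →
      overlap (n + 1) (x :: u) [y] = overlap (n + 1) [x] [y] := fun x y u hxy => by
    have := overlap_append (n + 1) (u₁ := [x]) (v₁ := [y]) (by simp [hxy]) u []
    rwa [hnil, add_zero] at this
  -- cutting off the part of the two rows that belongs to a long tile followed by a long tile
  have hcut : ∀ (x y x₁ x₂ y₁ y₂ : Tile) (u v : List Tile), x.length = y.length →
      x₁.length + x₂.length = y₁.length + y₂.length →
      overlap (n + 1) (x :: x₁ :: x₂ :: u) (y :: y₁ :: y₂ :: v)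
        = overlap (n + 1) [x] [y] + overlap (n + 1) [x₁, x₂] [y₁, y₂] + overlap (n + 1) u v := by
    intro x y x₁ x₂ y₁ y₂ u v h1 h2
    rw [add_assoc, ← overlap_append (n + 1) (by simpa using h2),
      ← overlap_append (n + 1) (by simpa using h1)]
    rfl
  -- cutting off the part that belongs to a long tile followed by a short tile
  have hcut' : ∀ (x y x₁ x₂ x₃ y₁ y₂ y₃ : Tile) (u v : List Tile), x.length = y.length →
      x₁.length + (x₂.length + x₃.length) = y₁.length + (y₂.length + y₃.length) →
      overlap (n + 1) (x :: x₁ :: x₂ :: x₃ :: u) (y :: y₁ :: y₂ :: y₃ :: v)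
        = overlap (n + 1) [x] [y] + overlap (n + 1) [x₁, x₂, x₃] [y₁, y₂, y₃]
          + overlap (n + 1) u v := by
    intro x y x₁ x₂ x₃ y₁ y₂ y₃ u v h1 h2
    rw [add_assoc, ← overlap_append (n + 1) (by simpa using h2),
      ← overlap_append (n + 1) (by simpa using h1)]
    rfl
  induction h with
  | a =>
    simp [Tile.inflate, Tile.long, Tile.short, adjacency]
    rw [hsingle _ _ _ (by simp [Tile.length]), overlap_a_abar]
  | abar =>
    simp [Tile.inflate, Tile.long, Tile.short, adjacency]
    rw [hsingle _ _ _ (by simp [Tile.length]), overlap_abar_a]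
  | cons_a h ih =>
    obtain ⟨v, rfl | rfl⟩ := h.exists_cons
    · simp [Tile.inflate, Tile.long, Tile.short, Tile.weight, adjacency] at ih ⊢
      rw [hcut _ _ _ _ _ _ _ _ (by simp [Tile.length]) (by simp [Tile.length]; ring), ih,
        overlap_a_abar, hX]
      ring
    · simp [Tile.inflate, Tile.long, Tile.short, Tile.weight, adjacency] at ih ⊢
      rw [hcut _ _ _ _ _ _ _ _ (by simp [Tile.length]) (by simp [Tile.length]; ring), ih,
        overlap_a_abar, hX₂]
      ring
  | cons_abar h ih =>
    obtain ⟨v, rfl | rfl⟩ := h.exists_cons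
    · simp [Tile.inflate, Tile.long, Tile.short, Tile.weight, adjacency] at ih ⊢
      rw [hcut _ _ _ _ _ _ _ _ (by simp [Tile.length]) (by simp [Tile.length]; ring), ih,
        overlap_abar_a, hX']
      ring
    · simp [Tile.inflate, Tile.long, Tile.short, Tile.weight, adjacency] at ih ⊢
      rw [hcut _ _ _ _ _ _ _ _ (by simp [Tile.length]) (by simp [Tile.length]; ring), ih,
        overlap_abar_a, hX₃]
      ring
  | cons_ab h ih =>
    simp [Tile.inflate, Tile.long, Tile.short, Tile.weight, adjacency] at ih ⊢
    rw [hcut' _ _ _ _ _ _ _ _ _ _ (by simp [Tile.length]) (by simp [Tile.length]; ring), ih,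
        overlap_a_abar, hZ]
    ring
  | cons_abar_bbar h ih =>
    simp [Tile.inflate, Tile.long, Tile.short, Tile.weight, adjacency] at ih ⊢
    rw [hcut' _ _ _ _ _ _ _ _ _ _ (by simp [Tile.length]) (by simp [Tile.length]; ring), ih,
        overlap_abar_a, hZ']
    ring

/-! ### The autocorrelation at the distances `(1 + λ) λⁿ` -/

/-- An inflated patterned word begins with a long and a short tile, whose supertiles make up the
distance in question. -/
lemma Patterned.autocorr_inflateWord {w : List Tile} (h : Patterned w) (n : ℕ) :
    corr (inflateWord^[n] (inflateWord w)) (inflateWord^[n] (inflateWord w))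
        ((1 + lam) * lam ^ n)
      = overlap n (inflateWord w) ((inflateWord w).drop 2) := by
  have key : ∀ u v : List Tile, span u = 1 + lam →
      corr (inflateWord^[n] (u ++ v)) (inflateWord^[n] (u ++ v)) ((1 + lam) * lam ^ n)
        = overlap n (u ++ v) v := by
    intro u v hu
    have hs : (1 + lam) * lam ^ n = span (inflateWord^[n] u) := by
      rw [span_iterate, hu, mul_comm]
    rw [hs, overlap]
    conv_lhs => rw [iterate_append n u v, corr_append_right, corr_of_span_le _ _ le_rfl, sub_self,
      zero_add, ← iterate_append]
  obtain ⟨v, rfl | rfl⟩ := h.exists_cons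
  · exact key [.a, .b] (.abar :: inflateWord v) (by simp [Tile.length]; ring)
  · exact key [.abar, .bbar] (.a :: inflateWord v) (by simp [Tile.length]; ring)

/-- `√2 - 1` is the inverse of `λ`. -/
lemma tendsto_div_of_abs_sub_lam_mul_le {f g : ℕ → ℝ} {C : ℝ}
    (h : ∀ n, |f n - lam * g n| ≤ C) (hf : Tendsto f atTop atTop) :
    Tendsto (fun n => g n / f n) atTop (𝓝 (√2 - 1)) := by
  have hl := two_lt_lam
  have h0 : Tendsto (fun n => (f n - lam * g n) / f n) atTop (𝓝 0) := by
    refine squeeze_zero_norm' ?_ (hf.const_div_atTop C)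
    filter_upwards [hf.eventually_gt_atTop 0] with n hn
    rw [norm_div, Real.norm_eq_abs, Real.norm_eq_abs, abs_of_pos hn]
    gcongr
    exact h n
  have h1 : Tendsto (fun n => (√2 - 1) * (1 - (f n - lam * g n) / f n)) atTop (𝓝 (√2 - 1)) := by
    simpa using (h0.const_sub 1).const_mul (√2 - 1)
  refine h1.congr' ?_
  filter_upwards [hf.eventually_gt_atTop 0] with n hn
  have hinv : (√2 - 1) * lam = 1 := by
    have : √2 ^ 2 = (2 : ℝ) := Real.sq_sqrt (by norm_num)
    unfold lam
    linear_combination this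
  field_simp
  linear_combination g n * hinv

lemma abs_longLen_sub_le (n : ℕ) : |longLen n - lam * shortLen n| ≤ 2 := by
  have hl := two_lt_lam
  have hl' := lam_lt_three
  induction n with
  | zero =>
    rw [longLen_zero, shortLen_zero, abs_le]
    constructor <;> linarith
  | succ n ih =>
    have h : lam * (longLen (n + 1) - lam * shortLen (n + 1))
        = -(longLen n - lam * shortLen n) := by
      rw [longLen_succ, shortLen_succ]
      linear_combination (-longLen n) * lam_sq
    rw [← abs_neg, ← h, abs_mul, abs_of_pos (by linarith)] at ih
    nlinarith [abs_nonneg (longLen (n + 1) - lam * shortLen (n + 1))]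

lemma tendsto_longCount_iterate :
    Tendsto (fun m => longCount (inflateWord^[m] [.a])) atTop atTop := by
  refine tendsto_atTop_mono (f := fun m => (2 / 3 : ℝ) * longLen m + -24) (fun m => ?_)
    (tendsto_atTop_add_const_right _ _ (tendsto_longLen.const_mul_atTop (by norm_num)))
  have h := (abs_le.1 (legal_iterate m .a).abs_discrepancy_le).1
  have h1 := shortCount_nonneg (inflateWord^[m] [.a])
  have h2 := two_lt_lam
  rw [longLen, length_eq]
  rw [discrepancy] at h
  nlinarith

/-- The exact autocorrelation at `(1 + λ) λⁿ⁺¹`; here `√2 - 1` is the asymptotic ratio of short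
to long tiles. -/
lemma IsUniformMean.eq_div {ν : ℝ} {n : ℕ}
    (h : IsUniformMean (fun w => corr w w ((1 + lam) * lam ^ (n + 1))) ν) :
    ν = (-longLen (n + 1) + (√2 - 1) * (longLen n + 2 * swapOverlap n)
          + (3 * (√2 - 1) - 1) * swapOverlap (n + 1))
        / (longLen (n + 2) + (√2 - 1) * longLen (n + 1)) := by
  set w : ℕ → List Tile := fun m => inflateWord^[m] [.a]
  have hw : ∀ m, inflateWord^[n + 1] (inflateWord (w m)) = inflateWord^[n + 2 + m] [.a] := by
    intro m
    rw [← Function.iterate_succ_apply, ← Function.iterate_add_apply]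
  have hlen := fun m => length_iterate (n + 2) (w m)
  have hlim := h.tendsto (l := atTop) (w := fun m => inflateWord^[n + 1] (inflateWord (w m)))
    (fun m => by rw [hw]; exact legal_iterate _ _) (by
      simp only [hw]
      exact tendsto_longLen.comp (tendsto_atTop_mono (fun m => Nat.le_add_left m _) tendsto_id))
  have hp := tendsto_longCount_iterate
  have hr : Tendsto (fun m => shortCount (w m) / longCount (w m)) atTop (𝓝 (√2 - 1)) :=
    tendsto_div_of_abs_sub_lam_mul_le (fun m => (legal_iterate m .a).abs_discrepancy_le) hp
  have hσ : Tendsto (fun m => (-1) ^ m / longCount (w m)) atTop (𝓝 0) := by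
    refine squeeze_zero_norm' ?_ (hp.const_div_atTop 1)
    filter_upwards [hp.eventually_gt_atTop 0] with m hm
    rw [norm_div, norm_pow, norm_neg, norm_one, one_pow, Real.norm_eq_abs, abs_of_pos hm]
  have h2 : (1 : ℝ) < √2 := Real.lt_sqrt_of_sq_lt (by norm_num)
  have hA1 := (le_shortLen (n + 1)).2.trans (shortLen_le_longLen (n + 1))
  have hA2 := (le_shortLen (n + 2)).2.trans (shortLen_le_longLen (n + 2))
  have hden : longLen (n + 2) + (√2 - 1) * longLen (n + 1) ≠ 0 := by nlinarith
  have hlim' := ((((hr.mul_const (longLen n + 2 * swapOverlap n)).const_add (-longLen (n + 1))).add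
    ((((hr.const_mul 3).sub_const 1).add hσ).mul_const (swapOverlap (n + 1)))).div
    ((hr.mul_const (longLen (n + 1))).const_add (longLen (n + 2))) hden)
  rw [add_zero] at hlim'
  refine tendsto_nhds_unique (hlim.congr' ?_) hlim'
  filter_upwards [hp.eventually_gt_atTop 0] with m hm
  have hpat := patterned_iterate m
  have hm' : longCount (w m) ≠ 0 := hm.ne'
  have e := hpat.overlap_drop n
  rw [adjacency_iterate] at e
  rw [hpat.autocorr_inflateWord (n + 1), e, ← Function.iterate_succ_apply, hlen, shortLen_succ]
  change (-longCount (w m) * _ + shortCount (w m) * _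
    + (3 * shortCount (w m) - longCount (w m) + _) * _) / _ = _
  rw [Pi.div_apply, eq_comm, ← mul_div_mul_left _ _ hm']
  congr 1
  · field_simp
  · field_simp

theorem tendsto_autocorr {ν : ℝ → ℝ} (h : ∀ z, IsUniformMean (fun w => corr w w z) (ν z)) :
    Tendsto (fun n : ℕ => ν ((1 + lam) * lam ^ n)) atTop (𝓝 (1 - √2)) := by
  rw [← tendsto_add_atTop_iff_nat 1]
  simp only [fun n : ℕ => (h ((1 + lam) * lam ^ (n + 1))).eq_div]
  have hA := tendsto_longLen
  have hs := tendsto_div_of_abs_sub_lam_mul_le abs_longLen_sub_le hA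
  have hτ : Tendsto (fun m => (-1) ^ m / longLen m) atTop (𝓝 0) := by
    refine squeeze_zero_norm' ?_ (hA.const_div_atTop 1)
    filter_upwards [hA.eventually_gt_atTop 0] with m hm
    rw [norm_div, norm_pow, norm_neg, norm_one, one_pow, Real.norm_eq_abs, abs_of_pos hm]
  have h2 : √2 ^ 2 = (2 : ℝ) := Real.sq_sqrt (by norm_num)
  have h2' : (1 : ℝ) < √2 := Real.lt_sqrt_of_sq_lt (by norm_num)
  -- numerator and denominator, relative to `longLen n`, as polynomials in `shortLen n / longLen n`
  -- and `(-1) ^ n / longLen n`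
  have hnum : Tendsto (fun n => -(2 + shortLen n / longLen n)
      + (√2 - 1) * (1 + 2 * (shortLen n / longLen n - 1 + (-1) ^ n / longLen n))
      + (3 * (√2 - 1) - 1) * (-1 - shortLen n / longLen n - (-1) ^ n / longLen n)) atTop
      (𝓝 (-(2 + (√2 - 1)) + (√2 - 1) * (1 + 2 * (√2 - 1 - 1 + 0))
        + (3 * (√2 - 1) - 1) * (-1 - (√2 - 1) - 0))) :=
    (((hs.const_add 2).neg).add (((((hs.sub_const 1).add hτ).const_mul 2).const_add 1).const_mul
      _)).add (((hs.const_sub (-1)).sub hτ).const_mul _)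
  have hden : Tendsto (fun n => 5 + 2 * (shortLen n / longLen n)
      + (√2 - 1) * (2 + shortLen n / longLen n)) atTop
      (𝓝 (5 + 2 * (√2 - 1) + (√2 - 1) * (2 + (√2 - 1)))) :=
    ((hs.const_mul 2).const_add 5).add ((hs.const_add 2).const_mul _)
  have hpos : 5 + 2 * (√2 - 1) + (√2 - 1) * (2 + (√2 - 1)) ≠ 0 := by nlinarith
  have hlim := hnum.div hden hpos
  have hval : (-(2 + (√2 - 1)) + (√2 - 1) * (1 + 2 * (√2 - 1 - 1 + 0))
        + (3 * (√2 - 1) - 1) * (-1 - (√2 - 1) - 0))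
        / (5 + 2 * (√2 - 1) + (√2 - 1) * (2 + (√2 - 1))) = 1 - √2 := by
    rw [div_eq_iff hpos]
    linear_combination √2 * h2
  rw [hval] at hlim
  refine hlim.congr' ?_
  filter_upwards [hA.eventually_gt_atTop 0] with n hn
  rw [Pi.div_apply, ← mul_div_mul_left _ _ hn.ne']
  simp only [swapOverlap, longLen_succ, shortLen_succ, pow_succ]
  congr 1
  · field_simp
    ring
  · field_simp
    ring

lemma tendsto_distance : Tendsto (fun n : ℕ => (1 + lam) * lam ^ n) atTop atTop := by
  have := two_lt_lam
  exact (tendsto_pow_atTop_atTop_of_one_lt (by linarith)).const_mul_atTop (by linarith)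

end TSM

theorem mainTheorem5 :
    TSM.hull.Nonempty ∧
    ∃ ν : ℝ → ℝ, TSM.IsAutocorrelation ν ∧
      Tendsto (fun n : ℕ => ν ((1 + TSM.lam) * TSM.lam ^ n)) atTop (𝓝 (1 - √2)) ∧
      ¬ Tendsto ν atTop (𝓝 0) := by
  choose ν hν using TSM.exists_isUniformMean_autocorr
  have hlim := TSM.tendsto_autocorr hν
  refine ⟨TSM.hull_nonempty, ν, TSM.isAutocorrelation_of_isUniformMean hν, hlim, fun h0 => ?_⟩
  have h1 := tendsto_nhds_unique hlim (h0.comp TSM.tendsto_distance)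
  have h2 : (1 : ℝ) < √2 := Real.lt_sqrt_of_sq_lt (by norm_num)
  linarith
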